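/- For a subset $E$ of the upper half-plane $\mathbb{H}=\{z\in\mathbb{C}:\operatorname{Im} z>0\}$ with at least two points, let $h_{\mathbb{H}}(E)$ be its diameter in the hyperbolic distance $h_{\mathbb{H}}$ induced by $|dz|/\operatorname{Im} z$, let $d(E)$ be its Euclidean diameter, let $d(E,\partial\mathbb{H})$ be its Euclidean distance to the boundary, and put $$J_{\mathbb{H}}(E)=\log\left(1+\frac{d(E)}{d(E,\partial\mathbb{H})}\right),\qquad \kappa(\mathbb{H})=\inf_E\frac{h_{\mathbb{H}}(E)}{J_{\mathbb{H}}(E)},$$ where $E$ runs over all compact subsets of $\mathbb{H}$ with at least two points. For $u>0$ let $$t(u)=\operatorname{arcosh}\frac{\cosh 2u}{\cosh u},\quad \theta(u)=2\arctan\left(\tanh\frac u2\right),\quad \chi(u)=2e^{t(u)}\sin\theta(u),\quad \xi(u)=\frac{2u}{\log(1+\chi(u))},$$ and $E^*(u)=\{i,\ ie^{t(u)+i\theta(u)},\ ie^{t(u)-i\theta(u)}\}$. **Theorem.** The equation $4\cosh^4u=\cosh 4u$ has a unique positive solution $u_0$, and $|u_0-0.831443|<10^{-6}$. There is a point $u^*\in(0,u_0)$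 with $\xi'(u^*)=0$ such that, with $z^*=ie^{t(u^*)+i\theta(u^*)}$, $w^*=ie^{t(u^*)-i\theta(u^*)}$ and $E^*=E^*(u^*)=\{i,z^*,w^*\}$: 1. $\displaystyle \kappa(\mathbb{H})=\xi(u^*)=\frac{h_{\mathbb{H}}(z^*,w^*)}{\log(1+|z^*-w^*|)}=\frac{h_{\mathbb{H}}(E^*)}{J_{\mathbb{H}}(E^*)}$; 2. $E^*$ is hyperbolically equilateral with side length $2u^*$: $h_{\mathbb{H}}(i,z^*)=h_{\mathbb{H}}(i,w^*)=h_{\mathbb{H}}(z^*,w^*)=2u^*$; 3. if $E\subset\mathbb{H}$ is a three-point set with $\kappa(\mathbb{H})=h_{\mathbb{H}}(E)/J_{\mathbb{H}}(E)$, then there are real numbers $a>0$ and $b$ such that $E=aE^*+b$. -/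

import Mathlib

open scoped UpperHalfPlane

noncomputable section

namespace HypDiam

/-- The Euclidean distance `d(E, F) = inf {|z - w| : z ∈ E, w ∈ F}` between two subsets of `ℂ`. -/
def euclDist (E F : Set ℂ) : ℝ :=
  sInf (Set.image2 (fun z w : ℂ => dist z w) E F)

/-- A subset of `ℍ`, seen as a subset of `ℂ`. -/
def toC (E : Set ℍ) : Set ℂ := (fun z : ℍ => (z : ℂ)) '' E

/-- The upper half-plane as a domain in `ℂ`. -/
def upperHalf : Set ℂ := {z : ℂ | 0 < z.im}

/-- The hyperbolic diameter `h_ℍ(E)`. The distance of `ℍ` is the hyperbolic distance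
induced by `|dz| / Im z`. -/
def hH (E : Set ℍ) : ℝ := Metric.diam E

/-- `J_ℍ(E) = log (1 + d(E) / d(E, ∂ℍ))`, where `d(E)` is the Euclidean diameter and
`d(E, ∂ℍ)` is the Euclidean distance to the boundary. -/
def JH (E : Set ℍ) : ℝ :=
  Real.log (1 + Metric.diam (toC E) / euclDist (toC E) (frontier upperHalf))

/-- `κ(ℍ)`, the infimum of `h_ℍ(E) / J_ℍ(E)` over all compact subsets `E` of `ℍ` with at least
two points. -/
def kappaH : ℝ :=
  sInf {r : ℝ | ∃ E : Set ℍ, IsCompact E ∧ E.Nontrivial ∧ r = hH E / JH E}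

/-- `t(u) = arcosh (cosh 2u / cosh u)`. -/
def tFun (u : ℝ) : ℝ := Real.arcosh (Real.cosh (2 * u) / Real.cosh u)

/-- `θ(u) = 2 arctan (tanh (u / 2))`. -/
def thetaFun (u : ℝ) : ℝ := 2 * Real.arctan (Real.tanh (u / 2))

/-- `χ(u) = 2 exp (arcosh (cosh 2u / cosh u)) sin (2 arctan (tanh (u / 2)))`. -/
def chi (u : ℝ) : ℝ :=
  2 * Real.exp (Real.arcosh (Real.cosh (2 * u) / Real.cosh u)) *
    Real.sin (2 * Real.arctan (Real.tanh (u / 2)))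

/-- `ξ(u) = 2u / log (1 + χ(u))`. -/
def xi (u : ℝ) : ℝ := 2 * u / Real.log (1 + chi u)

theorem cos_thetaFun_pos (u : ℝ) : 0 < Real.cos (thetaFun u) := by
  have h1 : Real.arctan (Real.tanh (u / 2)) < Real.pi / 4 := by
    rw [← Real.arctan_one]
    exact Real.arctan_strictMono (Real.tanh_lt_one _)
  have h2 : -(Real.pi / 4) < Real.arctan (Real.tanh (u / 2)) := by
    rw [← Real.arctan_one, ← Real.arctan_neg]
    exact Real.arctan_strictMono (Real.neg_one_lt_tanh _)
  apply Real.cos_pos_of_mem_Ioo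
  constructor <;> unfold thetaFun <;> linarith

theorem im_I_mul_exp (t θ : ℝ) :
    (Complex.I * Complex.exp ((t : ℂ) + Complex.I * (θ : ℂ))).im
      = Real.exp t * Real.cos θ := by
  simp [Complex.exp_re]

/-- The point `i e^{t(u) + iθ(u)}` of `ℍ`. -/
def zPt (u : ℝ) : ℍ :=
  ⟨Complex.I * Complex.exp ((tFun u : ℂ) + Complex.I * (thetaFun u : ℂ)), by
    rw [im_I_mul_exp]
    exact mul_pos (Real.exp_pos _) (cos_thetaFun_pos u)⟩

/-- The point `i e^{t(u) - iθ(u)}` of `ℍ`. -/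
def wPt (u : ℝ) : ℍ :=
  ⟨Complex.I * Complex.exp ((tFun u : ℂ) - Complex.I * (thetaFun u : ℂ)), by
    have h := im_I_mul_exp (tFun u) (-thetaFun u)
    rw [Complex.ofReal_neg, mul_neg, ← sub_eq_add_neg] at h
    rw [h, Real.cos_neg]
    exact mul_pos (Real.exp_pos _) (cos_thetaFun_pos u)⟩

/-- `E*(u) = {i, i e^{t(u) + iθ(u)}, i e^{t(u) - iθ(u)}}`. -/
def triple (u : ℝ) : Set ℍ := {UpperHalfPlane.I, zPt u, wPt u}

end HypDiam

end

/-! The ratio `h / J` of a compact set `E` does not increase when `E` is replaced by a lowest point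
`p` and two points `z`, `w` at maximal Euclidean distance, since `J` depends only on these points
(`exists_JH_eq`). An affine map takes `p` to `i`, and then `J = log (1 + |z - w|)`. Let
`2u` be the hyperbolic diameter of `E`, `s = sinh u`, and `m` the mean of `Im z` and `Im w`. The
distance `h(z, w) ≤ 2u` gives `|z - w| ≤ 2 s m`. The points `z` and `w` lie in the hyperbolic disc of
radius `2u` about `i`, which is a Euclidean disc with centre at height `cosh 2u`, and the
parallelogram law bounds `|z - w|²` by a quadratic polynomial in `m` that is largest at
`m = cosh 2u`. The two bounds agree at `m = M := exp t(u) / cosh u`.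
If `M ≥ cosh 2u`, which means `u ≤ u₀`, the best bound is `2 s M = χ(u)`, with equality only for the
upper points of the equilateral triple (`sq_dist_le_of_quadratic`). Beyond `u₀` the bound is the
diameter `2 sinh 2u` of the disc (`dist_div_im_le_maxDist`).

It remains to maximise `log (1 + maxDist u) / u` over `u > 0`. Beyond `u₀` it is decreasing by an
elementary argument (`log_one_add_two_sinh_div_lt`). On `(0, u₀]` the parameter
`p = 2 sinh u + √(3 + 4 sinh² u)` makes both `sinh u` and `χ(u) = 2p(p² - 3) / (p² + 9)` rational.
With `L(u) = log (1 + χ(u))`, the sign of `L''` is that of a polynomial in `p` which changes sign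
exactly once on the relevant range, from positive to negative (`exists_slopeNum_root`). Hence
`u L' - L`, which starts at `0`, first increases and then decreases; it is negative at `p = 3`, so it
has exactly one zero `u*` in the range, and `L(u) / u` increases before `u*` and decreases after it
(`exists_max_logChi_div_halfSide`). This yields existence and uniqueness of the extremal side length
(`exists_unique_max`), and the equality case of the distance bound gives the uniqueness of the
triple (`exists_affine_of_extremal`). -/

namespace HypDiam

/-! ### The ratio along equilateral triples -/

/-- The half side length `u` of an equilateral triple as a function of
`p = 2 sinh u + √(3 + 4 sinh² u)`, so that `sinh u = (p² - 3) / (4p)`. -/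
noncomputable def halfSide (p : ℝ) : ℝ := Real.arsinh ((p ^ 2 - 3) / (4 * p))

/-- `log (1 + χ)` in the parameter `p`, where `χ = 2p(p² - 3) / (p² + 9)`. -/
noncomputable def logChi (p : ℝ) : ℝ := Real.log (1 + 2 * p * (p ^ 2 - 3) / (p ^ 2 + 9))

/-- The algebraic factor of `slope` that is not rational in `p`. -/
noncomputable def rootFactor (p : ℝ) : ℝ := √((p ^ 2 + 1) / (p ^ 2 + 9))

/-- The derivative of `log (1 + χ)` with respect to the half side length `u`, as a function
of `p`. -/
noncomputable def slope (p : ℝ) : ℝ :=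
  2 * p * (p ^ 4 + 30 * p ^ 2 - 27) / ((2 * p ^ 3 + p ^ 2 - 6 * p + 9) * (p ^ 2 + 3)) *
    rootFactor p

/-- The polynomial carrying the sign of the derivative of `slope`. -/
def slopeNum (p : ℝ) : ℝ :=
  p ^ 12 - 104 * p ^ 11 + 24 * p ^ 10 - 576 * p ^ 9 + 981 * p ^ 8 - 1296 * p ^ 7 +
    11448 * p ^ 6 - 13824 * p ^ 5 + 35883 * p ^ 4 - 5832 * p ^ 3 + 11664 * p ^ 2 - 6561

lemma rootFactor_pos (p : ℝ) : 0 < rootFactor p := Real.sqrt_pos.2 (by positivity)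

lemma rootFactor_sq (p : ℝ) : rootFactor p ^ 2 = (p ^ 2 + 1) / (p ^ 2 + 9) :=
  Real.sq_sqrt (by positivity)

lemma cubic_pos {p : ℝ} (hp : 0 < p) : 0 < 2 * p ^ 3 + p ^ 2 - 6 * p + 9 := by
  nlinarith [mul_nonneg (sq_nonneg (p - 1)) (by linarith : 0 ≤ p + 2), sq_nonneg p]

lemma hasDerivAt_halfSide {p : ℝ} (hp : 0 < p) :
    HasDerivAt halfSide ((p ^ 2 + 3) / (p * (p ^ 2 + 9) * rootFactor p)) p := by
  have h1 : HasDerivAt (fun p : ℝ => (p ^ 2 - 3) / (4 * p))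
      ((2 * p * (4 * p) - (p ^ 2 - 3) * 4) / (4 * p) ^ 2) p := by
    refine (((hasDerivAt_pow 2 p).sub_const 3).div ((hasDerivAt_id p).const_mul 4)
      (by simpa using hp.ne')).congr_deriv ?_
    simp
  have h2 := h1.arsinh
  have hw : √(1 + ((p ^ 2 - 3) / (4 * p)) ^ 2) = (p ^ 2 + 9) * rootFactor p / (4 * p) := by
    rw [Real.sqrt_eq_iff_mul_self_eq (by positivity)
      (by have := rootFactor_pos p; positivity)]
    have h := rootFactor_sq p
    field_simp at h ⊢
    linear_combination -(p ^ 2 + 9) * h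
  refine h2.congr_deriv ?_
  rw [hw]
  have := rootFactor_pos p
  simp only [smul_eq_mul]
  field_simp
  ring

lemma one_add_chi_pos {p : ℝ} (hp : 0 < p) : 0 < 1 + 2 * p * (p ^ 2 - 3) / (p ^ 2 + 9) := by
  have h : 1 + 2 * p * (p ^ 2 - 3) / (p ^ 2 + 9) =
      (2 * p ^ 3 + p ^ 2 - 6 * p + 9) / (p ^ 2 + 9) := by
    field_simp
    ring
  rw [h]
  exact div_pos (cubic_pos hp) (by positivity)

lemma hasDerivAt_logChi {p : ℝ} (hp : 0 < p) :
    HasDerivAt logChi (2 * (p ^ 4 + 30 * p ^ 2 - 27) /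
      ((p ^ 2 + 9) * (2 * p ^ 3 + p ^ 2 - 6 * p + 9))) p := by
  have h1 : HasDerivAt (fun p : ℝ => 1 + 2 * p * (p ^ 2 - 3) / (p ^ 2 + 9))
      (((2 * (p ^ 2 - 3) + 2 * p * (2 * p)) * (p ^ 2 + 9) - 2 * p * (p ^ 2 - 3) * (2 * p)) /
        (p ^ 2 + 9) ^ 2) p := by
    refine (((((hasDerivAt_id p).const_mul 2).mul ((hasDerivAt_pow 2 p).sub_const 3)).div
      ((hasDerivAt_pow 2 p).add_const 9) (by positivity)).const_add 1).congr_deriv ?_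
    simp
  have h2 := h1.log (one_add_chi_pos hp).ne'
  refine h2.congr_deriv ?_
  have hc := cubic_pos hp
  have h : 1 + 2 * p * (p ^ 2 - 3) / (p ^ 2 + 9) =
      (2 * p ^ 3 + p ^ 2 - 6 * p + 9) / (p ^ 2 + 9) := by
    field_simp
    ring
  rw [h]
  have := hc.ne'
  field_simp
  ring

lemma hasDerivAt_rootFactor (p : ℝ) :
    HasDerivAt rootFactor (rootFactor p * (8 * p / ((p ^ 2 + 1) * (p ^ 2 + 9)))) p := by
  have h1 : HasDerivAt (fun p : ℝ => (p ^ 2 + 1) / (p ^ 2 + 9))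
      ((2 * p * (p ^ 2 + 9) - (p ^ 2 + 1) * (2 * p)) / (p ^ 2 + 9) ^ 2) p := by
    refine (((hasDerivAt_pow 2 p).add_const 1).div
      ((hasDerivAt_pow 2 p).add_const 9) (by positivity)).congr_deriv ?_
    simp
  have h2 := h1.sqrt (by positivity)
  refine h2.congr_deriv ?_
  have hr := rootFactor_pos p
  have hs := rootFactor_sq p
  change _ / (2 * rootFactor p) = _
  rw [eq_comm, eq_div_iff (by positivity)]
  have : rootFactor p * (8 * p / ((p ^ 2 + 1) * (p ^ 2 + 9))) * (2 * rootFactor p) =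
    rootFactor p ^ 2 * (16 * p / ((p ^ 2 + 1) * (p ^ 2 + 9))) := by ring
  rw [this, hs]
  field_simp
  ring

lemma hasDerivAt_slope {p : ℝ} (hp : 0 < p) :
    HasDerivAt slope (2 * rootFactor p * slopeNum p / ((p ^ 2 + 1) * (p ^ 2 + 9) *
      (2 * p ^ 3 + p ^ 2 - 6 * p + 9) ^ 2 * (p ^ 2 + 3) ^ 2)) p := by
  have hc := (cubic_pos hp).ne'
  have hn : HasDerivAt (fun p : ℝ => 2 * p * (p ^ 4 + 30 * p ^ 2 - 27))
      (10 * p ^ 4 + 180 * p ^ 2 - 54) p := by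
    refine (((hasDerivAt_id p).const_mul 2).mul
      (((hasDerivAt_pow 4 p).add ((hasDerivAt_pow 2 p).const_mul 30)).sub_const 27)).congr_deriv ?_
    simp
    ring
  have hd : HasDerivAt (fun p : ℝ => (2 * p ^ 3 + p ^ 2 - 6 * p + 9) * (p ^ 2 + 3))
      ((6 * p ^ 2 + 2 * p - 6) * (p ^ 2 + 3) +
        (2 * p ^ 3 + p ^ 2 - 6 * p + 9) * (2 * p)) p := by
    refine ((((((hasDerivAt_pow 3 p).const_mul 2).add (hasDerivAt_pow 2 p)).sub
      ((hasDerivAt_id p).const_mul 6)).add_const 9).mul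
        ((hasDerivAt_pow 2 p).add_const 3)).congr_deriv ?_
    simp
    exact Or.inl (by ring)
  have h := (hn.div hd (by positivity)).mul (hasDerivAt_rootFactor p)
  refine h.congr_deriv ?_
  unfold slopeNum
  simp only [Pi.div_apply]
  field_simp
  ring

lemma slope_mul_deriv_halfSide {p : ℝ} (hp : 0 < p) :
    slope p * ((p ^ 2 + 3) / (p * (p ^ 2 + 9) * rootFactor p)) =
      2 * (p ^ 4 + 30 * p ^ 2 - 27) / ((p ^ 2 + 9) * (2 * p ^ 3 + p ^ 2 - 6 * p + 9)) := by
  have hc := (cubic_pos hp).ne'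
  have := (rootFactor_pos p).ne'
  unfold slope
  field_simp

/-- After the shift `p = 1 + q` the coefficients of `slopeNum` change sign once, apart from the
harmless leading one; hence `slopeNum` changes sign at most once on `(1, 5]`. -/
lemma slopeNum_neg_of_nonpos {p p' : ℝ} (hp : 1 < p) (hlt : p < p') (hp' : p' ≤ 5)
    (h : slopeNum p ≤ 0) : slopeNum p' < 0 := by
  obtain ⟨q, rfl⟩ : ∃ q, p = 1 + q := ⟨p - 1, by ring⟩
  obtain ⟨r, rfl⟩ : ∃ r, p' = 1 + r := ⟨p' - 1, by ring⟩
  have hq : 0 < q := by linarith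
  have hqr : q < r := by linarith
  have hr : 0 < r := by linarith
  have hr4 : r ≤ 4 := by linarith
  have key : ∀ x : ℝ, 0 < x → slopeNum (1 + x) = x ^ 4 *
      ((31808 / x ^ 4 + 141632 / x ^ 3 + 217888 / x ^ 2 + 175552 / x + 60432) -
        (31200 * x + 60624 * x ^ 2 + 44832 * x ^ 3 + 5836 * x ^ 5 + 1054 * x ^ 6
          + 92 * x ^ 7) - (19788 * x ^ 4 - x ^ 8)) := by
    intro x hx
    unfold slopeNum
    field_simp
    ring
  rw [key q hq] at h
  rw [key r hr]
  have h0 := nonpos_of_mul_nonpos_right h (by positivity)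
  apply mul_neg_of_pos_of_neg (by positivity)
  have h1 : 31808 / r ^ 4 + 141632 / r ^ 3 + 217888 / r ^ 2 + 175552 / r + 60432 ≤
      31808 / q ^ 4 + 141632 / q ^ 3 + 217888 / q ^ 2 + 175552 / q + 60432 := by gcongr
  have h2 : 31200 * q + 60624 * q ^ 2 + 44832 * q ^ 3 + 5836 * q ^ 5 + 1054 * q ^ 6 + 92 * q ^ 7 <
      31200 * r + 60624 * r ^ 2 + 44832 * r ^ 3 + 5836 * r ^ 5 + 1054 * r ^ 6 + 92 * r ^ 7 := by
    gcongr
  -- `19788 x ^ 4 - x ^ 8` increases on `(0, 4]`, since `q ^ 4 + r ^ 4 ≤ 2 * 4 ^ 4`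
  have h3 : q ^ 4 ≤ r ^ 4 := by gcongr
  have h4 : r ^ 4 ≤ 4 ^ 4 := by gcongr
  have h5 : 0 ≤ (r ^ 4 - q ^ 4) * (19788 - r ^ 4 - q ^ 4) :=
    mul_nonneg (by linarith) (by linarith)
  nlinarith

lemma exists_slopeNum_root : ∃ c : ℝ, 2 < c ∧ c < 3 ∧ (∀ p, 1 < p → p < c → 0 < slopeNum p) ∧
    ∀ p, c < p → p ≤ 5 → slopeNum p < 0 := by
  have hcont : ContinuousOn slopeNum (Set.Icc 2 3) := by
    unfold slopeNum
    fun_prop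
  obtain ⟨c, hc, h0⟩ := intermediate_value_Ioo' (by norm_num : (2 : ℝ) ≤ 3) hcont
    (show (0 : ℝ) ∈ Set.Ioo (slopeNum 3) (slopeNum 2) by
      constructor <;> (unfold slopeNum; norm_num))
  refine ⟨c, hc.1, hc.2, fun p h1 h2 => ?_, fun p h1 h2 => ?_⟩
  · by_contra! h
    exact (slopeNum_neg_of_nonpos h1 h2 (by linarith [hc.2]) h).ne h0
  · exact slopeNum_neg_of_nonpos (by linarith [hc.1]) h1 h2 h0.le

/-- The numerator `u L'(u) - L(u)` of the derivative of `L(u) / u`, where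
`L(u) = log (1 + χ(u))`, in the parameter `p`. -/
noncomputable def critNum (p : ℝ) : ℝ := halfSide p * slope p - logChi p

lemma hasDerivAt_critNum {p : ℝ} (hp : 0 < p) :
    HasDerivAt critNum (halfSide p * (2 * rootFactor p * slopeNum p / ((p ^ 2 + 1) * (p ^ 2 + 9) *
      (2 * p ^ 3 + p ^ 2 - 6 * p + 9) ^ 2 * (p ^ 2 + 3) ^ 2))) p := by
  have h := ((hasDerivAt_halfSide hp).mul (hasDerivAt_slope hp)).sub (hasDerivAt_logChi hp)
  refine h.congr_deriv ?_
  have := slope_mul_deriv_halfSide hp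
  linear_combination this

lemma halfSide_pos {p : ℝ} (hp : √3 < p) : 0 < halfSide p := by
  have h0 : 0 < p := (Real.sqrt_nonneg 3).trans_lt hp
  have : 3 < p ^ 2 := (Real.sqrt_lt' h0).1 hp
  exact Real.arsinh_pos_iff.2 (div_pos (by linarith) (by linarith))

lemma sqrt_three_bounds : 1.732 < √3 ∧ √3 < 1.7321 := by
  constructor
  · exact Real.lt_sqrt_of_sq_lt (by norm_num)
  · exact (Real.sqrt_lt' (by norm_num)).2 (by norm_num)

lemma critNum_sqrt_three : critNum √3 = 0 := by
  simp [critNum, halfSide, logChi]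

/-- At `p = 3` one has `sinh u = 1 / 2`, `L' = √5` and `L = log 3`, so the claim reads
`√5 * log ((1 + √5) / 2) < log 3`. -/
lemma critNum_three_neg : critNum 3 < 0 := by
  have h5 : √5 < 2.237 := (Real.sqrt_lt' (by norm_num)).2 (by norm_num)
  have hs : slope 3 = √5 := by
    unfold slope rootFactor
    have : ((3 : ℝ) ^ 2 + 1) / (3 ^ 2 + 9) = 5 / 3 ^ 2 := by norm_num
    rw [this, Real.sqrt_div (by norm_num), Real.sqrt_sq (by norm_num)]
    ring
  have hl : logChi 3 = Real.log 3 := by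
    unfold logChi
    norm_num
  have hu : halfSide 3 < 0.49 := by
    unfold halfSide Real.arsinh
    rw [Real.log_lt_iff_lt_exp (by positivity)]
    have h1 : √(1 + (((3 : ℝ) ^ 2 - 3) / (4 * 3)) ^ 2) < 1.12 :=
      (Real.sqrt_lt' (by norm_num)).2 (by norm_num)
    have h2 := Real.sum_le_exp_of_nonneg (show (0 : ℝ) ≤ 0.49 by norm_num) 4
    norm_num [Finset.sum_range_succ, Nat.factorial] at h2
    norm_num at h1 ⊢
    linarith
  have h3 : 1.0962 < Real.log 3 := by
    rw [Real.lt_log_iff_exp_lt (by norm_num)]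
    have h1 := Real.exp_bound' (show (0 : ℝ) ≤ 0.5481 by norm_num) (by norm_num)
      (n := 6) (by norm_num)
    norm_num [Finset.sum_range_succ, Nat.factorial] at h1
    have h2 : Real.exp 1.0962 = Real.exp 0.5481 ^ 2 := by
      rw [← Real.exp_nat_mul]
      norm_num
    rw [h2]
    have := Real.exp_pos 0.5481
    norm_num at this ⊢
    nlinarith
  unfold critNum
  rw [hs, hl]
  have h0 : 0 ≤ √5 := Real.sqrt_nonneg 5
  nlinarith

lemma exists_critNum_root : ∃ q : ℝ, √3 < q ∧ q < 3 ∧ (∀ p, √3 < p → p < q → 0 < critNum p) ∧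
    ∀ p, q < p → p ≤ 5 → critNum p < 0 := by
  obtain ⟨c, hc2, hc3, hpos, hneg⟩ := exists_slopeNum_root
  obtain ⟨h3, h3'⟩ := sqrt_three_bounds
  have hcont : ∀ a b : ℝ, 0 < a → ContinuousOn critNum (Set.Icc a b) := fun a b ha x hx =>
    (hasDerivAt_critNum (ha.trans_le hx.1)).continuousAt.continuousWithinAt
  have hmono : StrictMonoOn critNum (Set.Icc √3 c) := by
    apply strictMonoOn_of_deriv_pos (convex_Icc _ _) (hcont _ _ (by linarith))
    intro x hx
    rw [interior_Icc] at hx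
    have hx0 : 0 < x := by linarith [hx.1]
    rw [(hasDerivAt_critNum hx0).deriv]
    have := halfSide_pos hx.1
    have := rootFactor_pos x
    have := hpos x (by linarith [hx.1]) hx.2
    have := cubic_pos hx0
    positivity
  have hanti : StrictAntiOn critNum (Set.Icc c 5) := by
    apply strictAntiOn_of_deriv_neg (convex_Icc _ _) (hcont _ _ (by linarith))
    intro x hx
    rw [interior_Icc] at hx
    have hx0 : 0 < x := by linarith [hx.1]
    rw [(hasDerivAt_critNum hx0).deriv]
    have := rootFactor_pos x
    have := cubic_pos hx0
    apply mul_neg_of_pos_of_neg (halfSide_pos (by linarith [hx.1]))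
    exact div_neg_of_neg_of_pos
      (mul_neg_of_pos_of_neg (by positivity) (hneg x hx.1 hx.2.le)) (by positivity)
  have hleft : ∀ p, √3 < p → p ≤ c → 0 < critNum p := fun p h1 h2 => by
    rw [← critNum_sqrt_three]
    exact hmono ⟨le_rfl, by linarith⟩ ⟨h1.le, h2⟩ h1
  obtain ⟨q, hq, h0⟩ := intermediate_value_Ioo' hc3.le (hcont c 3 (by linarith))
    (show (0 : ℝ) ∈ Set.Ioo (critNum 3) (critNum c) from
      ⟨critNum_three_neg, hleft c (by linarith) le_rfl⟩)
  refine ⟨q, by linarith [hq.1], hq.2, fun p h1 h2 => ?_, fun p h1 h2 => ?_⟩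
  · rcases le_or_gt p c with h | h
    · exact hleft p h1 h
    · rw [← h0]
      exact hanti ⟨h.le, by linarith [hq.2]⟩ ⟨hq.1.le, by linarith [hq.2]⟩ h2
  · rw [← h0]
    exact hanti ⟨hq.1.le, by linarith [hq.2]⟩ ⟨by linarith [hq.1], h2⟩ h1

lemma hasDerivAt_logChi_div_halfSide {p : ℝ} (hp : √3 < p) :
    HasDerivAt (fun p => logChi p / halfSide p)
      ((p ^ 2 + 3) / (p * (p ^ 2 + 9) * rootFactor p) * critNum p / halfSide p ^ 2) p := by
  have hp0 : 0 < p := (Real.sqrt_nonneg 3).trans_lt hp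
  have h := (hasDerivAt_logChi hp0).div (hasDerivAt_halfSide hp0) (halfSide_pos hp).ne'
  refine h.congr_deriv ?_
  rw [← slope_mul_deriv_halfSide hp0, critNum]
  ring

/-- `log (1 + χ) / u` has a unique maximum point in the range `√3 < p ≤ 5`, it is strictly
increasing before and strictly decreasing after it. -/
lemma exists_max_logChi_div_halfSide : ∃ q : ℝ, √3 < q ∧ q < 3 ∧
    (∀ p, √3 < p → p < q → logChi p / halfSide p < logChi q / halfSide q) ∧
    StrictAntiOn (fun p => logChi p / halfSide p) (Set.Icc q 5) := by
  obtain ⟨q, hq1, hq3, hpos, hneg⟩ := exists_critNum_root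
  have h3 := sqrt_three_bounds.1
  have hcont : ∀ a b : ℝ, √3 < a →
      ContinuousOn (fun p => logChi p / halfSide p) (Set.Icc a b) := fun a b ha x hx =>
    (hasDerivAt_logChi_div_halfSide (ha.trans_le hx.1)).continuousAt.continuousWithinAt
  refine ⟨q, hq1, hq3, fun p h1 h2 => ?_, ?_⟩
  · have : StrictMonoOn (fun p => logChi p / halfSide p) (Set.Icc p q) := by
      apply strictMonoOn_of_deriv_pos (convex_Icc _ _) (hcont _ _ h1)
      intro x hx
      rw [interior_Icc] at hx
      have hx1 : √3 < x := h1.trans hx.1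
      have hx0 : 0 < x := by linarith
      rw [(hasDerivAt_logChi_div_halfSide hx1).deriv]
      have := halfSide_pos hx1
      have := rootFactor_pos x
      have := hpos x hx1 hx.2
      positivity
    exact this ⟨le_rfl, h2.le⟩ ⟨h2.le, le_rfl⟩ h2
  · apply strictAntiOn_of_deriv_neg (convex_Icc _ _) (hcont _ _ hq1)
    intro x hx
    rw [interior_Icc] at hx
    have hx1 : √3 < x := hq1.trans hx.1
    have hx0 : 0 < x := by linarith
    rw [(hasDerivAt_logChi_div_halfSide hx1).deriv]
    have := halfSide_pos hx1
    have := rootFactor_pos x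
    exact div_neg_of_neg_of_pos (mul_neg_of_pos_of_neg (by positivity)
      (hneg x hx.1 hx.2.le)) (by positivity)

/-! ### The triples in the algebraic parameter -/

/-- The algebraic parameter `p = 2 sinh u + √(3 + 4 sinh² u)` of the side length `2u`. -/
noncomputable def param (u : ℝ) : ℝ := 2 * Real.sinh u + √(3 + 4 * Real.sinh u ^ 2)

/-- The common height `exp t(u) / cosh u` of the two upper points of `triple u`. -/
noncomputable def height (u : ℝ) : ℝ := 4 * param u ^ 2 / (param u ^ 2 + 9)

lemma strictMono_param : StrictMonoOn param (Set.Ici 0) := by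
  intro a ha b hb hab
  have h0 : 0 ≤ Real.sinh a := Real.sinh_nonneg_iff.2 ha
  have h1 : Real.sinh a < Real.sinh b := Real.sinh_lt_sinh.2 hab
  unfold param
  gcongr

lemma param_zero : param 0 = √3 := by simp [param]

lemma sqrt_three_lt_param {u : ℝ} (hu : 0 < u) : √3 < param u := by
  rw [← param_zero]
  exact strictMono_param (Set.mem_Ici.2 le_rfl) (Set.mem_Ici.2 hu.le) hu

lemma param_pos (u : ℝ) : 0 < param u := by
  have h : |2 * Real.sinh u| < √(3 + 4 * Real.sinh u ^ 2) :=
    Real.lt_sqrt_of_sq_lt (by rw [sq_abs]; linarith [sq_nonneg (Real.sinh u)])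
  have := neg_abs_le (2 * Real.sinh u)
  unfold param
  linarith

lemma param_sq (u : ℝ) : param u ^ 2 = 3 + 4 * Real.sinh u * param u := by
  have h : √(3 + 4 * Real.sinh u ^ 2) ^ 2 = 3 + 4 * Real.sinh u ^ 2 :=
    Real.sq_sqrt (by positivity)
  unfold param
  linear_combination h

lemma sinh_eq_param (u : ℝ) : Real.sinh u = (param u ^ 2 - 3) / (4 * param u) := by
  have := param_pos u
  field_simp
  linarith [param_sq u]

lemma halfSide_param (u : ℝ) : halfSide (param u) = u := by
  rw [halfSide, ← sinh_eq_param, Real.arsinh_sinh]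

lemma param_halfSide {p : ℝ} (hp : 0 < p) : param (halfSide p) = p := by
  unfold param halfSide
  rw [Real.sinh_arsinh]
  have : √(3 + 4 * ((p ^ 2 - 3) / (4 * p)) ^ 2) = (p ^ 2 + 3) / (2 * p) := by
    rw [Real.sqrt_eq_iff_mul_self_eq (by positivity) (by positivity)]
    field_simp
    ring
  rw [this]
  field_simp
  ring

lemma height_mul_cosh_sq (u : ℝ) :
    height u * Real.cosh u ^ 2 = 1 + Real.sinh u * param u := by
  have := param_pos u
  rw [Real.cosh_sq', sinh_eq_param, height]
  field_simp
  ring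

/-- The height is the larger solution of the quadratic equation saying that the two upper
points lie on the hyperbolic circle of radius `2u` about `i`. -/
lemma height_quadratic (u : ℝ) :
    (1 + Real.sinh u ^ 2) * height u ^ 2 - 2 * (1 + 2 * Real.sinh u ^ 2) * height u + 1 = 0 := by
  have := param_pos u
  rw [sinh_eq_param, height]
  field_simp
  ring

lemma height_pos (u : ℝ) : 0 < height u := by
  have := param_pos u
  unfold height
  positivity

lemma one_lt_height {u : ℝ} (hu : 0 < u) : 1 < height u := by
  have h0 := param_pos u
  have : 3 < param u ^ 2 := (Real.sqrt_lt' h0).1 (sqrt_three_lt_param hu)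
  rw [height, one_lt_div (by positivity)]
  linarith

lemma exp_tFun {u : ℝ} (hu : 0 ≤ u) : Real.exp (tFun u) = height u * Real.cosh u := by
  have hx : 1 ≤ Real.cosh u := Real.one_le_cosh u
  have hx0 : 0 < Real.cosh u := by linarith
  have hs : 0 ≤ Real.sinh u := Real.sinh_nonneg_iff.2 hu
  have hC : Real.cosh (2 * u) = 1 + 2 * Real.sinh u ^ 2 := by
    rw [Real.cosh_two_mul, Real.cosh_sq']
    ring
  have hq := Real.sqrt_nonneg (3 + 4 * Real.sinh u ^ 2)
  have hq2 : √(3 + 4 * Real.sinh u ^ 2) ^ 2 = 3 + 4 * Real.sinh u ^ 2 :=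
    Real.sq_sqrt (by positivity)
  have h3 := height_mul_cosh_sq u
  rw [param] at h3
  set q := √(3 + 4 * Real.sinh u ^ 2)
  have h1 : 1 ≤ Real.cosh (2 * u) / Real.cosh u := by
    rw [one_le_div hx0, hC]
    nlinarith [Real.cosh_sq' u]
  have h2 : √((Real.cosh (2 * u) / Real.cosh u) ^ 2 - 1) =
      Real.sinh u * q / Real.cosh u := by
    rw [Real.sqrt_eq_iff_mul_self_eq (by nlinarith) (by positivity), hC]
    field_simp
    rw [hq2, Real.cosh_sq']
    ring
  rw [tFun, Real.exp_arcosh h1, h2, hC]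
  field_simp
  linear_combination -h3

lemma sin_thetaFun (u : ℝ) : Real.sin (thetaFun u) = Real.sinh u / Real.cosh u := by
  have hx : 0 < Real.cosh (u / 2) := Real.cosh_pos _
  have h1 := Real.cosh_two_mul (u / 2)
  have h2 := Real.sinh_two_mul (u / 2)
  rw [mul_div_cancel₀ u two_ne_zero] at h1 h2
  unfold thetaFun
  rw [Real.sin_two_mul, Real.sin_arctan, Real.cos_arctan, h1, h2, Real.tanh_eq_sinh_div_cosh]
  have h3 : √(1 + (Real.sinh (u / 2) / Real.cosh (u / 2)) ^ 2) ^ 2 =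
      1 + (Real.sinh (u / 2) / Real.cosh (u / 2)) ^ 2 := Real.sq_sqrt (by positivity)
  have h4 : 0 < √(1 + (Real.sinh (u / 2) / Real.cosh (u / 2)) ^ 2) :=
    Real.sqrt_pos.2 (by positivity)
  set q := √(1 + (Real.sinh (u / 2) / Real.cosh (u / 2)) ^ 2)
  have h5 : q ^ 2 * Real.cosh (u / 2) ^ 2 = Real.cosh (u / 2) ^ 2 + Real.sinh (u / 2) ^ 2 := by
    rw [h3]
    field_simp
  field_simp
  linear_combination -Real.sinh (u / 2) * h5

lemma cos_thetaFun (u : ℝ) : Real.cos (thetaFun u) = 1 / Real.cosh u := by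
  have h1 := Real.sin_sq_add_cos_sq (thetaFun u)
  have h2 := cos_thetaFun_pos u
  have hx : 0 < Real.cosh u := Real.cosh_pos _
  rw [sin_thetaFun] at h1
  rw [← sq_eq_sq₀ h2.le (by positivity)]
  have h3 := Real.cosh_sq' u
  field_simp at h1 ⊢
  linarith

lemma chi_eq {u : ℝ} (hu : 0 ≤ u) : chi u = 2 * Real.sinh u * height u := by
  change 2 * Real.exp (tFun u) * Real.sin (thetaFun u) = _
  have hx : 0 < Real.cosh u := Real.cosh_pos _
  rw [exp_tFun hu, sin_thetaFun]
  field_simp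

lemma chi_pos {u : ℝ} (hu : 0 < u) : 0 < chi u := by
  rw [chi_eq hu.le]
  have := height_pos u
  have := Real.sinh_pos_iff.2 hu
  positivity

lemma log_one_add_chi {u : ℝ} (hu : 0 ≤ u) : Real.log (1 + chi u) = logChi (param u) := by
  have := param_pos u
  rw [chi_eq hu, logChi, height]
  nth_rewrite 1 [sinh_eq_param]
  congr 2
  field_simp

lemma zPt_im {u : ℝ} (hu : 0 ≤ u) : (zPt u).im = height u := by
  have hx : 0 < Real.cosh u := Real.cosh_pos _
  change (Complex.I * Complex.exp ((tFun u : ℂ) + Complex.I * (thetaFun u : ℂ))).im = _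
  rw [im_I_mul_exp, exp_tFun hu, cos_thetaFun]
  field_simp

lemma zPt_re {u : ℝ} (hu : 0 ≤ u) : (zPt u).re = -(Real.sinh u * height u) := by
  have hx : 0 < Real.cosh u := Real.cosh_pos _
  change (Complex.I * Complex.exp ((tFun u : ℂ) + Complex.I * (thetaFun u : ℂ))).re = _
  have : (Complex.I * Complex.exp ((tFun u : ℂ) + Complex.I * (thetaFun u : ℂ))).re =
      -(Real.exp (tFun u) * Real.sin (thetaFun u)) := by simp [Complex.exp_im]
  rw [this, exp_tFun hu, sin_thetaFun]
  field_simp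

lemma wPt_im {u : ℝ} (hu : 0 ≤ u) : (wPt u).im = height u := by
  have hx : 0 < Real.cosh u := Real.cosh_pos _
  change (Complex.I * Complex.exp ((tFun u : ℂ) - Complex.I * (thetaFun u : ℂ))).im = _
  have : (Complex.I * Complex.exp ((tFun u : ℂ) - Complex.I * (thetaFun u : ℂ))).im =
      Real.exp (tFun u) * Real.cos (thetaFun u) := by simp [Complex.exp_re]
  rw [this, exp_tFun hu, cos_thetaFun]
  field_simp

lemma wPt_re {u : ℝ} (hu : 0 ≤ u) : (wPt u).re = Real.sinh u * height u := by
  have hx : 0 < Real.cosh u := Real.cosh_pos _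
  change (Complex.I * Complex.exp ((tFun u : ℂ) - Complex.I * (thetaFun u : ℂ))).re = _
  have : (Complex.I * Complex.exp ((tFun u : ℂ) - Complex.I * (thetaFun u : ℂ))).re =
      Real.exp (tFun u) * Real.sin (thetaFun u) := by simp [Complex.exp_im]
  rw [this, exp_tFun hu, sin_thetaFun]
  field_simp

/-! ### The critical side length -/

/-- The solution `u₀` of `4 cosh⁴ u = cosh 4u`, for which the base of the equilateral triple is
the horizontal diameter of the hyperbolic disc of radius `2u₀` about `i`. -/
noncomputable def uZero : ℝ := Real.arsinh √(√3 / 2)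

lemma uZero_pos : 0 < uZero := Real.arsinh_pos_iff.2 (by positivity)

lemma sinh_uZero_sq : Real.sinh uZero ^ 2 = √3 / 2 := by
  rw [uZero, Real.sinh_arsinh, Real.sq_sqrt (by positivity)]

/-- With `k = sinh² v` the equation reads `4 k² = 3`. -/
lemma cosh_eq_iff_sinh (v : ℝ) :
    4 * Real.cosh v ^ 4 = Real.cosh (4 * v) ↔ Real.sinh v ^ 2 = √3 / 2 := by
  have h3 : √3 ^ 2 = 3 := Real.sq_sqrt (by norm_num)
  have h : Real.cosh (4 * v) = 8 * Real.cosh v ^ 4 - 8 * Real.cosh v ^ 2 + 1 := by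
    rw [show 4 * v = 2 * (2 * v) by ring, Real.cosh_two_mul, Real.sinh_sq, Real.cosh_two_mul,
      Real.sinh_sq]
    ring
  have hc : Real.cosh v ^ 4 = (1 + Real.sinh v ^ 2) ^ 2 := by rw [← Real.cosh_sq']; ring
  rw [h, hc, Real.cosh_sq']
  constructor
  · intro h1
    rw [← sq_eq_sq₀ (by positivity) (by positivity)]
    linear_combination (-1 / 4) * h1 - (1 / 4) * h3
  · intro h1
    rw [h1]
    linear_combination -h3

lemma eq_uZero {v : ℝ} (hv : 0 < v) (h : 4 * Real.cosh v ^ 4 = Real.cosh (4 * v)) :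
    v = uZero := by
  rw [cosh_eq_iff_sinh] at h
  rw [uZero, ← h, Real.sqrt_sq (Real.sinh_nonneg_iff.2 hv.le), Real.arsinh_sinh]

lemma sinh_uZero_bounds : 0.930604 < Real.sinh uZero ∧ Real.sinh uZero < 0.930605 := by
  have h3 : 1.73205 < √3 := Real.lt_sqrt_of_sq_lt (by norm_num)
  have h3' : √3 < 1.73205081 := (Real.sqrt_lt' (by norm_num)).2 (by norm_num)
  have h := sinh_uZero_sq
  have h0 := Real.sinh_pos_iff.2 uZero_pos
  constructor
  · nlinarith
  · nlinarith

lemma abs_uZero_sub_lt : |uZero - 0.831443| < 1 / 10 ^ 6 := by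
  have hs := sinh_uZero_sq
  have h0 := Real.sinh_pos_iff.2 uZero_pos
  have h3 : 1.7320508 < √3 := Real.lt_sqrt_of_sq_lt (by norm_num)
  have h3' : √3 < 1.7320509 := (Real.sqrt_lt' (by norm_num)).2 (by norm_num)
  rw [abs_sub_lt_iff]
  constructor
  · have h : uZero < 0.831444 := by
      rw [← Real.sinh_lt_sinh, Real.sinh_eq 0.831444]
      have h1 := Real.sum_le_exp_of_nonneg (show (0 : ℝ) ≤ 0.831444 by norm_num) 11
      norm_num [Finset.sum_range_succ, Nat.factorial] at h1
      have h2 : (2.296632 : ℝ) ≤ Real.exp 0.831444 := by norm_num at h1 ⊢; linarith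
      have h4 : Real.exp (-0.831444) ≤ 1 / 2.296632 := by
        rw [Real.exp_neg, ← one_div]
        gcongr
      have h6 : Real.sinh uZero < 0.9306055 := by nlinarith
      norm_num at h2 h4 h6 ⊢
      linarith
    norm_num at h ⊢
    linarith
  · have h : 0.831442 < uZero := by
      rw [← Real.sinh_lt_sinh, Real.sinh_eq 0.831442]
      have h1 := Real.exp_bound' (show (0 : ℝ) ≤ 0.831442 by norm_num) (by norm_num)
        (n := 11) (by norm_num)
      norm_num [Finset.sum_range_succ, Nat.factorial] at h1
      have h2 : Real.exp 0.831442 ≤ (2.296629 : ℝ) := by norm_num at h1 ⊢; linarith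
      have h4 : 1 / 2.296629 ≤ Real.exp (-0.831442) := by
        rw [Real.exp_neg, ← one_div]
        gcongr
      have h6 : 0.9306045 < Real.sinh uZero := by nlinarith
      norm_num at h2 h4 h6 ⊢
      linarith
    norm_num at h ⊢
    linarith

lemma param_uZero_bounds : 3 < param uZero ∧ param uZero ≤ 5 := by
  obtain ⟨h1, h2⟩ := sinh_uZero_bounds
  have h4 : √(3 + 4 * Real.sinh uZero ^ 2) < 3 :=
    (Real.sqrt_lt' (by norm_num)).2 (by nlinarith)
  have h5 : 2 < √(3 + 4 * Real.sinh uZero ^ 2) := Real.lt_sqrt_of_sq_lt (by nlinarith)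
  unfold param
  constructor <;> linarith

/-- Up to the critical side length the upper points of the equilateral triple lie at least as high
as the Euclidean centre of the hyperbolic disc of radius `2u` about `i`. -/
lemma center_le_height {u : ℝ} (hu : 0 ≤ u) (hu0 : u ≤ uZero) :
    1 + 2 * Real.sinh u ^ 2 ≤ height u := by
  have hs : 0 ≤ Real.sinh u := Real.sinh_nonneg_iff.2 hu
  have hk : Real.sinh u ^ 2 ≤ √3 / 2 := by
    rw [← sinh_uZero_sq]
    have := Real.sinh_le_sinh.2 hu0
    gcongr
  have h3 : √3 ^ 2 = 3 := Real.sq_sqrt (by norm_num)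
  have hq : (1 + 2 * Real.sinh u ^ 2) * Real.sinh u ≤ √(3 + 4 * Real.sinh u ^ 2) := by
    apply Real.le_sqrt_of_sq_le
    have : 4 * (Real.sinh u ^ 2) ^ 2 ≤ 3 := by
      calc 4 * (Real.sinh u ^ 2) ^ 2 ≤ 4 * (√3 / 2) ^ 2 := by gcongr
        _ = 3 := by linear_combination h3
    have h4 := mul_nonneg (by positivity : 0 ≤ Real.sinh u ^ 2 + 1) (sub_nonneg.2 this)
    nlinarith
  have h := height_mul_cosh_sq u
  rw [Real.cosh_sq', param] at h
  have h5 := mul_le_mul_of_nonneg_left hq hs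
  have h6 : (1 + 2 * Real.sinh u ^ 2) * (1 + Real.sinh u ^ 2) ≤
      height u * (1 + Real.sinh u ^ 2) := by nlinarith
  exact le_of_mul_le_mul_right h6 (by positivity)

lemma chi_uZero : chi uZero = 2 * Real.sinh (2 * uZero) := by
  have h3 : √3 ^ 2 = 3 := Real.sq_sqrt (by norm_num)
  have hs := sinh_uZero_sq
  have hs0 := Real.sinh_pos_iff.2 uZero_pos
  have hc0 := Real.cosh_pos uZero
  have hc2 := Real.cosh_sq' uZero
  have hc : Real.cosh uZero = (1 + √3) / 2 := by
    rw [← sq_eq_sq₀ hc0.le (by positivity), hc2, hs]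
    linear_combination -h3 / 4
  have hq : √(3 + 4 * Real.sinh uZero ^ 2) = (1 + √3) * Real.sinh uZero := by
    rw [Real.sqrt_eq_iff_mul_self_eq (by positivity) (by positivity)]
    linear_combination 4 * hs - (1 + √3) ^ 2 * hs - (√3 / 2 + 1) * h3
  have h := height_mul_cosh_sq uZero
  have hh : height uZero = 1 + √3 := by
    have h0 : height uZero * Real.cosh uZero ^ 2 = (1 + √3) * Real.cosh uZero ^ 2 := by
      rw [h, hc2, param, hq]
      linear_combination 2 * hs
    exact mul_right_cancel₀ (pow_pos hc0 2).ne' h0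
  rw [chi_eq uZero_pos.le, hh, Real.sinh_two_mul, hc]
  ring

/-! ### The optimal side length -/

/-- The largest Euclidean distance of two points whose hyperbolic distances to each other and to
a third point `i` are at most `2u`. -/
noncomputable def maxDist (u : ℝ) : ℝ := if u ≤ uZero then chi u else 2 * Real.sinh (2 * u)

lemma maxDist_pos {u : ℝ} (hu : 0 < u) : 0 < maxDist u := by
  unfold maxDist
  split_ifs
  · exact chi_pos hu
  · have : 0 < Real.sinh (2 * u) := Real.sinh_pos_iff.2 (by linarith)
    linarith

/-- `log (1 + 2 sinh s) / s = 1 + log (1 + y - y²) / s` with `y = exp (-s)`, and `y - y²` increases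
for `y ≤ 1 / 2`. -/
lemma log_one_add_two_sinh_div_lt {s t : ℝ} (hs : Real.log 2 ≤ s) (hst : s < t) :
    Real.log (1 + 2 * Real.sinh t) / t < Real.log (1 + 2 * Real.sinh s) / s := by
  have hs0 : 0 < s := (Real.log_pos one_lt_two).trans_le hs
  have ht0 : 0 < t := hs0.trans hst
  have key : ∀ r : ℝ, 0 < r → 0 < Real.exp (-r) - Real.exp (-r) ^ 2 ∧
      Real.log (1 + 2 * Real.sinh r) / r =
        1 + Real.log (1 + (Real.exp (-r) - Real.exp (-r) ^ 2)) / r := by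
    intro r hr
    have h1 : Real.exp (-r) < 1 := Real.exp_lt_one_iff.2 (by linarith)
    have h2 := Real.exp_pos (-r)
    have h3 : 0 < Real.exp (-r) - Real.exp (-r) ^ 2 := by nlinarith
    refine ⟨h3, ?_⟩
    have h4 : 1 + 2 * Real.sinh r =
        Real.exp r * (1 + (Real.exp (-r) - Real.exp (-r) ^ 2)) := by
      rw [Real.sinh_eq]
      have : Real.exp r * Real.exp (-r) = 1 := by rw [← Real.exp_add]; simp
      linear_combination (Real.exp (-r) - 1) * this
    rw [h4, Real.log_mul (Real.exp_pos r).ne' (by linarith), Real.log_exp]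
    field_simp
  rw [(key s hs0).2, (key t ht0).2]
  have hx : Real.exp (-s) ≤ 1 / 2 := by
    rw [Real.exp_neg, ← one_div]
    gcongr
    rwa [← Real.log_le_iff_le_exp two_pos]
  have hxy : Real.exp (-t) < Real.exp (-s) := Real.exp_lt_exp.2 (by linarith)
  have h5 : Real.exp (-t) - Real.exp (-t) ^ 2 ≤ Real.exp (-s) - Real.exp (-s) ^ 2 := by
    nlinarith
  have h6 : 0 < Real.log (1 + (Real.exp (-s) - Real.exp (-s) ^ 2)) :=
    Real.log_pos (by linarith [(key s hs0).1])
  have h7 : Real.log (1 + (Real.exp (-t) - Real.exp (-t) ^ 2)) ≤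
      Real.log (1 + (Real.exp (-s) - Real.exp (-s) ^ 2)) :=
    Real.log_le_log (by linarith [(key t ht0).1]) (by linarith)
  have h8 : Real.log (1 + (Real.exp (-t) - Real.exp (-t) ^ 2)) / t <
      Real.log (1 + (Real.exp (-s) - Real.exp (-s) ^ 2)) / s := by
    calc _ ≤ Real.log (1 + (Real.exp (-s) - Real.exp (-s) ^ 2)) / t := by gcongr
      _ < _ := by gcongr
  linarith

/-- The maximum of `log (1 + maxDist u) / u` over `u > 0` is attained at exactly one point, which
lies in `(0, u₀)`. -/
lemma exists_unique_max : ∃ v : ℝ, 0 < v ∧ v < uZero ∧ ∀ u, 0 < u → u ≠ v →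
    Real.log (1 + maxDist u) / u < Real.log (1 + chi v) / v := by
  obtain ⟨q, hq1, hq3, hlt, hanti⟩ := exists_max_logChi_div_halfSide
  obtain ⟨hb1, hb2⟩ := param_uZero_bounds
  have hq0 : 0 < q := (Real.sqrt_nonneg 3).trans_lt hq1
  have hv := halfSide_pos hq1
  have hpv : param (halfSide q) = q := param_halfSide hq0
  have hsmall : ∀ u, 0 < u → u ≤ uZero → u ≠ halfSide q →
      Real.log (1 + chi u) / u < Real.log (1 + chi (halfSide q)) / halfSide q := by
    intro u hu hu0 hne
    have h5 : param u ≤ 5 :=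
      (strictMono_param.monotoneOn (Set.mem_Ici.2 hu.le) (Set.mem_Ici.2 uZero_pos.le) hu0).trans
        hb2
    have hpne : param u ≠ q := fun h => hne (by rw [← h, halfSide_param])
    rw [log_one_add_chi hu.le, log_one_add_chi hv.le, hpv]
    nth_rewrite 2 [← halfSide_param u]
    rcases lt_or_gt_of_ne hpne with h | h
    · exact hlt _ (sqrt_three_lt_param hu) h
    · exact hanti ⟨le_rfl, by linarith⟩ ⟨h.le, h5⟩ h
  have hv0 : halfSide q < uZero := by
    rw [← strictMono_param.lt_iff_lt (Set.mem_Ici.2 hv.le) (Set.mem_Ici.2 uZero_pos.le), hpv]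
    linarith
  refine ⟨halfSide q, hv, hv0, fun u hu hne => ?_⟩
  unfold maxDist
  split_ifs with h
  · exact hsmall u hu h hne
  · push Not at h
    have h1 := hsmall uZero uZero_pos le_rfl hv0.ne'
    have hlog : Real.log 2 ≤ 2 * uZero := by
      have h2 := (abs_sub_lt_iff.1 abs_uZero_sub_lt).2
      have h3 := Real.log_two_lt_d9
      norm_num at h2 h3
      linarith
    have h2 := log_one_add_two_sinh_div_lt hlog (by linarith : 2 * uZero < 2 * u)
    rw [chi_uZero] at h1
    refine lt_trans ?_ h1
    have h0 := uZero_pos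
    rw [div_lt_div_iff₀ (by positivity) (by positivity)] at h2 ⊢
    linarith

/-! ### Triples of given hyperbolic diameter -/

/-- The parallelogram law in the Euclidean disc of centre `(0, 1 + 2s²)` that represents the
hyperbolic disc of radius `2u` about `i`, where `s = sinh u`. -/
lemma sq_dist_le_of_mem_disc {s x₁ y₁ x₂ y₂ : ℝ} (h₁ : x₁ ^ 2 + (y₁ - 1) ^ 2 ≤ 4 * s ^ 2 * y₁)
    (h₂ : x₂ ^ 2 + (y₂ - 1) ^ 2 ≤ 4 * s ^ 2 * y₂) :
    (x₁ - x₂) ^ 2 + (y₁ - y₂) ^ 2 + (x₁ + x₂) ^ 2 ≤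
      4 * (4 * s ^ 2 * ((y₁ + y₂) / 2) - ((y₁ + y₂) / 2 - 1) ^ 2) := by
  nlinarith

/-- The quadratic equation for `M` says that the bound `4 s² m²`, increasing in the mean height
`m`, and the bound of `sq_dist_le_of_mem_disc`, decreasing in `m` above the centre, agree at
`m = M`. -/
lemma sq_dist_le_of_quadratic {s M x₁ y₁ x₂ y₂ : ℝ} (hs : 0 < s)
    (hM : (1 + s ^ 2) * M ^ 2 - 2 * (1 + 2 * s ^ 2) * M + 1 = 0) (hC : 1 + 2 * s ^ 2 ≤ M)
    (hy₁ : 0 < y₁) (hy₂ : 0 < y₂)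
    (h₁ : x₁ ^ 2 + (y₁ - 1) ^ 2 ≤ 4 * s ^ 2 * y₁)
    (h₂ : x₂ ^ 2 + (y₂ - 1) ^ 2 ≤ 4 * s ^ 2 * y₂)
    (h₃ : (x₁ - x₂) ^ 2 + (y₁ - y₂) ^ 2 ≤ 4 * s ^ 2 * (y₁ * y₂)) :
    (x₁ - x₂) ^ 2 + (y₁ - y₂) ^ 2 ≤ 4 * s ^ 2 * M ^ 2 ∧
      ((x₁ - x₂) ^ 2 + (y₁ - y₂) ^ 2 = 4 * s ^ 2 * M ^ 2 →
        y₁ = M ∧ y₂ = M ∧ x₂ = -x₁ ∧ x₁ ^ 2 = (s * M) ^ 2) := by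
  have h₄ := sq_dist_le_of_mem_disc h₁ h₂
  have hs2 : 0 < s ^ 2 := by positivity
  obtain ⟨m, hm⟩ : ∃ m, m = (y₁ + y₂) / 2 := ⟨_, rfl⟩
  rw [← hm] at h₄
  have hm0 : 0 < m := by linarith
  have h₅ : y₁ * y₂ = m ^ 2 - (y₁ - y₂) ^ 2 / 4 := by rw [hm]; ring
  rw [h₅] at h₃
  -- only `m = M` allows equality, and there the defects `y₁ - y₂` and `x₁ + x₂` must vanish
  rcases lt_trichotomy m M with h | h | h
  · have h₆ : m ^ 2 < M ^ 2 := by gcongr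
    have h₇ : s ^ 2 * m ^ 2 < s ^ 2 * M ^ 2 := by gcongr
    have h₈ : (x₁ - x₂) ^ 2 + (y₁ - y₂) ^ 2 < 4 * s ^ 2 * M ^ 2 := by
      nlinarith [mul_nonneg hs2.le (sq_nonneg (y₁ - y₂))]
    exact ⟨h₈.le, fun h => absurd h h₈.ne⟩
  · rw [h] at h₃ h₄
    refine ⟨by nlinarith [mul_nonneg hs2.le (sq_nonneg (y₁ - y₂))], fun h₆ => ?_⟩
    have h₇ : (y₁ - y₂) ^ 2 ≤ 0 := by
      have : s ^ 2 * (y₁ - y₂) ^ 2 ≤ s ^ 2 * 0 := by linarith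
      exact le_of_mul_le_mul_left this hs2
    have h₈ : (x₁ + x₂) ^ 2 ≤ 0 := by nlinarith
    have h₉ : y₁ = y₂ := by
      have := pow_eq_zero_iff two_ne_zero |>.1 (le_antisymm h₇ (sq_nonneg _))
      linarith
    have h₁₀ : x₂ = -x₁ := by
      have := pow_eq_zero_iff two_ne_zero |>.1 (le_antisymm h₈ (sq_nonneg _))
      linarith
    refine ⟨by linarith, by linarith, h₁₀, ?_⟩
    rw [h₉, h₁₀] at h₆
    linarith
  · have h₆ : 0 < (m - M) * (m + M - 2 * (1 + 2 * s ^ 2)) :=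
      mul_pos (by linarith) (by linarith)
    have h₈ : (x₁ - x₂) ^ 2 + (y₁ - y₂) ^ 2 < 4 * s ^ 2 * M ^ 2 := by
      nlinarith [sq_nonneg (x₁ + x₂)]
    exact ⟨h₈.le, fun h => absurd h h₈.ne⟩

lemma dist_coe_sq (z w : ℍ) :
    dist (z : ℂ) w ^ 2 = (z.re - w.re) ^ 2 + (z.im - w.im) ^ 2 := by
  rw [Complex.dist_eq_re_im, Real.sq_sqrt (by positivity)]
  rfl

lemma dist_le_two_mul_iff {u : ℝ} (hu : 0 ≤ u) (z w : ℍ) :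
    dist z w ≤ 2 * u ↔
      (z.re - w.re) ^ 2 + (z.im - w.im) ^ 2 ≤ 4 * Real.sinh u ^ 2 * (z.im * w.im) := by
  have hz := z.im_pos
  have hw := w.im_pos
  have hs := Real.sinh_nonneg_iff.2 hu
  rw [UpperHalfPlane.dist_le_iff_le_sinh, ← dist_coe_sq, mul_div_cancel_left₀ u two_ne_zero,
    div_le_iff₀ (by positivity), ← sq_le_sq₀ dist_nonneg (by positivity), mul_pow, mul_pow,
    Real.sq_sqrt (by positivity)]
  ring_nf

lemma dist_eq_two_mul {u : ℝ} (hu : 0 ≤ u) (z w : ℍ)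
    (h : (z.re - w.re) ^ 2 + (z.im - w.im) ^ 2 = 4 * Real.sinh u ^ 2 * (z.im * w.im)) :
    dist z w = 2 * u := by
  have hz := z.im_pos
  have hw := w.im_pos
  rw [UpperHalfPlane.dist_eq_iff_eq_sq_sinh (by linarith), dist_coe_sq, h,
    mul_div_cancel_left₀ u two_ne_zero]
  field_simp

/-- The normalisation of a pair of points by the affine map taking `p` to `i`. -/
lemma normalized_bounds {u : ℝ} (hu : 0 ≤ u) {p z w : ℍ} (hpz : dist z p ≤ 2 * u)
    (hpw : dist w p ≤ 2 * u) (hzw : dist z w ≤ 2 * u) :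
    ((z.re - p.re) / p.im) ^ 2 + (z.im / p.im - 1) ^ 2 ≤
        4 * Real.sinh u ^ 2 * (z.im / p.im) ∧
      ((w.re - p.re) / p.im) ^ 2 + (w.im / p.im - 1) ^ 2 ≤
        4 * Real.sinh u ^ 2 * (w.im / p.im) ∧
      ((z.re - p.re) / p.im - (w.re - p.re) / p.im) ^ 2 + (z.im / p.im - w.im / p.im) ^ 2 ≤
        4 * Real.sinh u ^ 2 * (z.im / p.im * (w.im / p.im)) := by
  have hp := p.im_pos
  rw [dist_le_two_mul_iff hu] at hpz hpw hzw
  refine ⟨?_, ?_, ?_⟩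
  · field_simp
    linarith
  · field_simp
    linarith
  · field_simp
    linarith

lemma normalized_dist (p z w : ℍ) :
    ((z.re - p.re) / p.im - (w.re - p.re) / p.im) ^ 2 + (z.im / p.im - w.im / p.im) ^ 2 =
      (dist (z : ℂ) w / p.im) ^ 2 := by
  have hp := p.im_pos
  rw [div_pow, dist_coe_sq]
  field_simp
  ring

lemma dist_div_im_le_maxDist {u : ℝ} (hu : 0 < u) {p z w : ℍ} (hpz : dist z p ≤ 2 * u)
    (hpw : dist w p ≤ 2 * u) (hzw : dist z w ≤ 2 * u) :
    dist (z : ℂ) w / p.im ≤ maxDist u := by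
  have hp := p.im_pos
  have hs := Real.sinh_pos_iff.2 hu
  obtain ⟨h₁, h₂, h₃⟩ := normalized_bounds hu.le hpz hpw hzw
  rw [← sq_le_sq₀ (by positivity) (maxDist_pos hu).le, ← normalized_dist, maxDist]
  split_ifs with h
  · refine (sq_dist_le_of_quadratic hs (height_quadratic u)
      (center_le_height hu.le h) (div_pos z.im_pos hp) (div_pos w.im_pos hp) h₁ h₂ h₃).1.trans_eq ?_
    rw [chi_eq hu.le]
    ring
  · have h₄ := sq_dist_le_of_mem_disc h₁ h₂
    rw [Real.sinh_two_mul, mul_pow, mul_pow, mul_pow, Real.cosh_sq']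
    nlinarith [sq_nonneg ((z.im / p.im + w.im / p.im) / 2 - (1 + 2 * Real.sinh u ^ 2)),
      sq_nonneg ((z.re - p.re) / p.im + (w.re - p.re) / p.im)]

/-- In the extremal case the triple is the image of the equilateral one under the affine map taking
`i` to `p`. -/
lemma eq_of_dist_div_im_eq_chi {u : ℝ} (hu : 0 < u) (hu0 : u ≤ uZero) {p z w : ℍ}
    (hpz : dist z p ≤ 2 * u) (hpw : dist w p ≤ 2 * u) (hzw : dist z w ≤ 2 * u)
    (h : dist (z : ℂ) w / p.im = chi u) :
    z.im = p.im * height u ∧ w.im = p.im * height u ∧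
      ((z.re = p.re + p.im * (Real.sinh u * height u) ∧
          w.re = p.re - p.im * (Real.sinh u * height u)) ∨
        (z.re = p.re - p.im * (Real.sinh u * height u) ∧
          w.re = p.re + p.im * (Real.sinh u * height u))) := by
  have hp := p.im_pos
  have hs := Real.sinh_pos_iff.2 hu
  obtain ⟨h₁, h₂, h₃⟩ := normalized_bounds hu.le hpz hpw hzw
  obtain ⟨a, b, c, d⟩ := (sq_dist_le_of_quadratic hs (height_quadratic u)
    (center_le_height hu.le hu0) (div_pos z.im_pos hp) (div_pos w.im_pos hp) h₁ h₂ h₃).2 (by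
      rw [normalized_dist, h, chi_eq hu.le]
      ring)
  rw [div_eq_iff hp.ne'] at a b
  rw [← neg_div, div_left_inj' hp.ne'] at c
  refine ⟨by linarith, by linarith, ?_⟩
  rcases sq_eq_sq_iff_eq_or_eq_neg.1 d with e | e <;> rw [div_eq_iff hp.ne'] at e
  · exact Or.inl ⟨by linarith, by linarith⟩
  · exact Or.inr ⟨by linarith, by linarith⟩

/-! ### The equilateral triple -/

lemma dist_I_zPt {u : ℝ} (hu : 0 ≤ u) : dist UpperHalfPlane.I (zPt u) = 2 * u := by
  apply dist_eq_two_mul hu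
  rw [zPt_re hu, zPt_im hu, UpperHalfPlane.I_re, UpperHalfPlane.I_im]
  linear_combination height_quadratic u

lemma dist_I_wPt {u : ℝ} (hu : 0 ≤ u) : dist UpperHalfPlane.I (wPt u) = 2 * u := by
  apply dist_eq_two_mul hu
  rw [wPt_re hu, wPt_im hu, UpperHalfPlane.I_re, UpperHalfPlane.I_im]
  linear_combination height_quadratic u

lemma dist_zPt_wPt {u : ℝ} (hu : 0 ≤ u) : dist (zPt u) (wPt u) = 2 * u := by
  apply dist_eq_two_mul hu
  rw [zPt_re hu, zPt_im hu, wPt_re hu, wPt_im hu]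
  ring

lemma dist_coe_zPt_wPt {u : ℝ} (hu : 0 < u) : dist (zPt u : ℂ) (wPt u) = chi u := by
  rw [← sq_eq_sq₀ dist_nonneg (chi_pos hu).le, dist_coe_sq, zPt_re hu.le, zPt_im hu.le,
    wPt_re hu.le, wPt_im hu.le, chi_eq hu.le]
  ring

lemma dist_coe_I_le_chi {u : ℝ} (hu : 0 < u) {z : ℍ} (hz : dist UpperHalfPlane.I z = 2 * u)
    (him : z.im = height u) : dist ((UpperHalfPlane.I : ℍ) : ℂ) z ≤ chi u := by
  have h := (dist_le_two_mul_iff hu.le _ _).1 hz.le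
  rw [← sq_le_sq₀ dist_nonneg (chi_pos hu).le, dist_coe_sq]
  refine h.trans ?_
  rw [UpperHalfPlane.I_im, him, chi_eq hu.le]
  have h1 := one_lt_height hu
  have : height u ≤ height u ^ 2 := by nlinarith
  have := mul_le_mul_of_nonneg_left this (sq_nonneg (Real.sinh u))
  linarith

/-! ### Compact sets -/

lemma frontier_upperHalf : frontier upperHalf = {z : ℂ | z.im = 0} :=
  Complex.frontier_setOfPred_lt_im 0

/-- The distance to the boundary is the least imaginary part. -/
lemma euclDist_frontier_eq {E : Set ℍ} {p : ℍ} (hp : p ∈ E) (hmin : ∀ z ∈ E, p.im ≤ z.im) :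
    euclDist (toC E) (frontier upperHalf) = p.im := by
  rw [euclDist, frontier_upperHalf]
  apply IsLeast.csInf_eq
  constructor
  · refine ⟨(p : ℂ), ⟨p, hp, rfl⟩, ((p.re : ℝ) : ℂ), Complex.ofReal_im _, ?_⟩
    simp only
    rw [Complex.dist_of_re_eq (by simp)]
    simp [abs_of_pos p.im_pos]
  · rintro _ ⟨_, ⟨z, hz, rfl⟩, w, hw, rfl⟩
    refine (hmin z hz).trans ?_
    have h := Complex.abs_im_le_norm ((z : ℂ) - w)
    rw [Complex.sub_im, show w.im = 0 from hw, sub_zero, ← dist_eq_norm] at h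
    exact (le_abs_self _).trans h

lemma exists_diam_eq_dist {X : Type*} [MetricSpace X] {K : Set X} (hK : IsCompact K)
    (hne : K.Nonempty) : ∃ x ∈ K, ∃ y ∈ K, Metric.diam K = dist x y := by
  obtain ⟨⟨x, y⟩, ⟨hx, hy⟩, hmax⟩ := (hK.prod hK).exists_isMaxOn (hne.prod hne)
    (continuous_dist.continuousOn (s := K ×ˢ K))
  exact ⟨x, hx, y, hy, le_antisymm
    (Metric.diam_le_of_forall_dist_le dist_nonneg fun a ha b hb => hmax (Set.mk_mem_prod ha hb))
    (Metric.dist_le_diam_of_mem hK.isBounded hx hy)⟩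

/-- The value of `J` on a compact set is determined by a lowest point and two points at maximal
Euclidean distance. -/
lemma exists_JH_eq {E : Set ℍ} (hE : IsCompact E) (hne : E.Nonempty) :
    ∃ p ∈ E, ∃ z ∈ E, ∃ w ∈ E, JH E = Real.log (1 + dist (z : ℂ) w / p.im) := by
  obtain ⟨p, hp, hmin⟩ := hE.exists_isMinOn hne UpperHalfPlane.continuous_im.continuousOn
  have hC : IsCompact (toC E) := hE.image UpperHalfPlane.continuous_coe
  obtain ⟨_, ⟨z, hz, rfl⟩, _, ⟨w, hw, rfl⟩, h⟩ := exists_diam_eq_dist hC (hne.image _)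
  refine ⟨p, hp, z, hz, w, hw, ?_⟩
  rw [JH, h, euclDist_frontier_eq hp (fun z hz => hmin hz)]

lemma hH_pos {E : Set ℍ} (hE : IsCompact E) (hne : E.Nontrivial) : 0 < hH E :=
  Metric.diam_pos hne hE.isBounded

lemma JH_pos {E : Set ℍ} (hE : IsCompact E) (hne : E.Nontrivial) : 0 < JH E := by
  obtain ⟨p, hp, hmin⟩ := hE.exists_isMinOn hne.nonempty UpperHalfPlane.continuous_im.continuousOn
  have hC : IsCompact (toC E) := hE.image UpperHalfPlane.continuous_coe
  rw [JH, euclDist_frontier_eq hp (fun z hz => hmin hz)]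
  have h1 : 0 < Metric.diam (toC E) :=
    Metric.diam_pos (hne.image UpperHalfPlane.coe_injective) hC.isBounded
  have h2 := div_pos h1 p.im_pos
  exact Real.log_pos (by linarith)

/-- A compact set of hyperbolic diameter `2u` satisfies `J ≤ log (1 + maxDist u)`. -/
lemma JH_le_log_maxDist {E : Set ℍ} (hE : IsCompact E) (hne : E.Nontrivial) :
    JH E ≤ Real.log (1 + maxDist (hH E / 2)) := by
  obtain ⟨p, hp, z, hz, w, hw, h⟩ := exists_JH_eq hE hne.nonempty
  have hd : ∀ a ∈ E, ∀ b ∈ E, dist a b ≤ 2 * (hH E / 2) := fun a ha b hb => by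
    rw [mul_div_cancel₀ _ two_ne_zero]
    exact Metric.dist_le_diam_of_mem hE.isBounded ha hb
  have := div_nonneg (dist_nonneg (x := (z : ℂ)) (y := w)) p.im_pos.le
  rw [h]
  apply Real.log_le_log (by linarith)
  linarith [dist_div_im_le_maxDist (half_pos (hH_pos hE hne)) (hd z hz p hp) (hd w hw p hp)
    (hd z hz w hw)]

lemma triple_isCompact (u : ℝ) : IsCompact (triple u) :=
  Set.Finite.isCompact (by unfold triple; exact Set.toFinite _)

lemma triple_nontrivial {u : ℝ} (hu : 0 < u) : (triple u).Nontrivial := by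
  refine ⟨UpperHalfPlane.I, by simp [triple], zPt u, by simp [triple], fun h => ?_⟩
  have := dist_I_zPt hu.le
  rw [← h, dist_self] at this
  linarith

lemma hH_triple {u : ℝ} (hu : 0 < u) : hH (triple u) = 2 * u := by
  have h1 := dist_I_zPt hu.le
  have h2 := dist_I_wPt hu.le
  have h3 := dist_zPt_wPt hu.le
  apply le_antisymm
  · apply Metric.diam_le_of_forall_dist_le (by linarith)
    rintro a (rfl | rfl | rfl) b (rfl | rfl | rfl) <;>
      simp only [dist_self, h1, h2, h3, dist_comm (zPt u) UpperHalfPlane.I,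
        dist_comm (wPt u) UpperHalfPlane.I, dist_comm (wPt u) (zPt u)] <;> linarith
  · rw [← h1]
    exact Metric.dist_le_diam_of_mem (triple_isCompact u).isBounded (by simp [triple])
      (by simp [triple])

lemma JH_triple {u : ℝ} (hu : 0 < u) : JH (triple u) = Real.log (1 + chi u) := by
  have hmin : ∀ z ∈ triple u, UpperHalfPlane.I.im ≤ z.im := by
    have h := one_lt_height hu
    rintro a (rfl | rfl | rfl)
    · exact le_rfl
    · rw [zPt_im hu.le, UpperHalfPlane.I_im]
      exact h.le
    · rw [wPt_im hu.le, UpperHalfPlane.I_im]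
      exact h.le
  have h1 := dist_coe_I_le_chi hu (dist_I_zPt hu.le) (zPt_im hu.le)
  have h2 := dist_coe_I_le_chi hu (dist_I_wPt hu.le) (wPt_im hu.le)
  have h3 := dist_coe_zPt_wPt hu
  have hc := chi_pos hu
  have hd : Metric.diam (toC (triple u)) = chi u := by
    apply le_antisymm
    · apply Metric.diam_le_of_forall_dist_le hc.le
      rintro _ ⟨a, (rfl | rfl | rfl), rfl⟩ _ ⟨b, (rfl | rfl | rfl), rfl⟩
      · simpa using hc.le
      · exact h1
      · exact h2
      · exact (dist_comm _ _).trans_le h1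
      · simpa using hc.le
      · exact h3.le
      · exact (dist_comm _ _).trans_le h2
      · exact (dist_comm _ _).trans_le h3.le
      · simpa using hc.le
    · rw [← h3]
      exact Metric.dist_le_diam_of_mem
        ((triple_isCompact u).image UpperHalfPlane.continuous_coe).isBounded
        ⟨zPt u, by simp [triple], rfl⟩ ⟨wPt u, by simp [triple], rfl⟩
  rw [JH, hd, euclDist_frontier_eq (by simp [triple]) hmin, UpperHalfPlane.I_im, div_one]

lemma hH_div_JH_triple {u : ℝ} (hu : 0 < u) : hH (triple u) / JH (triple u) = xi u := by
  rw [hH_triple hu, JH_triple hu, xi]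

/-! ### The extremal value -/

lemma xi_le_of_log_div_le {u v : ℝ} (hu : 0 < u) (hv : 0 < v) {L : ℝ} (hL : 0 < L)
    (h : L / u ≤ Real.log (1 + chi v) / v) : xi v ≤ 2 * u / L := by
  have h0 : 0 < Real.log (1 + chi v) := Real.log_pos (by linarith [chi_pos hv])
  rw [div_le_div_iff₀ hu hv] at h
  rw [xi, div_le_div_iff₀ h0 hL]
  linarith

lemma kappaH_eq_xi {v : ℝ} (hv : 0 < v)
    (hmax : ∀ u, 0 < u → Real.log (1 + maxDist u) / u ≤ Real.log (1 + chi v) / v) :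
    kappaH = xi v := by
  apply IsLeast.csInf_eq
  constructor
  · exact ⟨triple v, triple_isCompact v, triple_nontrivial hv, (hH_div_JH_triple hv).symm⟩
  · rintro _ ⟨E, hE, hne, rfl⟩
    have h1 := hH_pos hE hne
    have h2 := JH_pos hE hne
    have h3 := xi_le_of_log_div_le (half_pos h1) hv h2 (le_trans
      (div_le_div_of_nonneg_right (JH_le_log_maxDist hE hne) (half_pos h1).le)
      (hmax _ (half_pos h1)))
    rwa [mul_div_cancel₀ _ two_ne_zero] at h3

lemma differentiableAt_xi {v : ℝ} (hv : 0 < v) : DifferentiableAt ℝ xi v := by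
  have hp : DifferentiableAt ℝ param v := by
    unfold param
    have h1 := Real.differentiable_sinh v
    exact (h1.const_mul 2).add (DifferentiableAt.sqrt (by fun_prop) (by positivity))
  have hl : DifferentiableAt ℝ (fun u => logChi (param u)) v :=
    (hasDerivAt_logChi (param_pos v)).differentiableAt.comp v hp
  have h0 : logChi (param v) ≠ 0 := by
    rw [← log_one_add_chi hv.le]
    exact (Real.log_pos (by linarith [chi_pos hv])).ne'
  have h2 : DifferentiableAt ℝ (fun u => 2 * u / logChi (param u)) v :=
    DifferentiableAt.fun_div (by fun_prop) hl h0
  -- `chi` is algebraic in `param` for `u ≥ 0` only, which is enough near `v`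
  apply h2.congr_of_eventuallyEq
  filter_upwards [lt_mem_nhds hv] with u hu
  rw [xi, log_one_add_chi hu.le]

lemma hasDerivAt_xi_zero {v : ℝ} (hv : 0 < v) (hv0 : v < uZero)
    (hmax : ∀ u, 0 < u → Real.log (1 + maxDist u) / u ≤ Real.log (1 + chi v) / v) :
    HasDerivAt xi 0 v := by
  have hmin : IsLocalMin xi v := by
    filter_upwards [lt_mem_nhds hv, gt_mem_nhds hv0] with u hu hu0
    have h := hmax u hu
    rw [maxDist, if_pos hu0.le] at h
    exact xi_le_of_log_div_le hu hv (Real.log_pos (by linarith [chi_pos hu])) h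
  have h := (differentiableAt_xi hv).hasDerivAt
  rwa [hmin.deriv_eq_zero] at h

lemma coe_eq_of_re_im {z p q : ℍ} (hre : z.re = p.re + p.im * q.re) (him : z.im = p.im * q.im) :
    (z : ℂ) = (p.im : ℂ) * (q : ℂ) + (p.re : ℂ) := by
  apply Complex.ext
  · simp [hre, add_comm]
  · simp [him]

/-- Equality in `JH_le_log_maxDist` forces a three-point set to be an affine image of the
equilateral triple. -/
lemma exists_affine_of_extremal {v : ℝ} (hv : 0 < v) (hv0 : v < uZero)
    (hmax : ∀ u, 0 < u → u ≠ v →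
      Real.log (1 + maxDist u) / u < Real.log (1 + chi v) / v)
    {E : Set ℍ} (hE : E.ncard = 3) (hext : xi v = hH E / JH E) :
    ∃ a b : ℝ, 0 < a ∧
      toC E = (fun z : ℂ => (a : ℂ) * z + (b : ℂ)) '' toC (triple v) := by
  have hfin : E.Finite := Set.finite_of_ncard_ne_zero (by omega)
  have hc : IsCompact E := hfin.isCompact
  have := hfin.to_subtype
  have hne : E.Nontrivial := Set.one_lt_ncard_iff_nontrivial.1 (by omega)
  have h1 := hH_pos hc hne
  have h2 := JH_pos hc hne
  have hL : 0 < Real.log (1 + chi v) := Real.log_pos (by linarith [chi_pos hv])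
  have hext' : JH E / (hH E / 2) = Real.log (1 + chi v) / v := by
    rw [xi] at hext
    field_simp at hext ⊢
    linarith
  have hhalf : hH E / 2 = v := by
    by_contra h
    refine (hmax _ (half_pos h1) h).not_ge ?_
    rw [← hext']
    exact div_le_div_of_nonneg_right (JH_le_log_maxDist hc hne) (half_pos h1).le
  have hJ : JH E = Real.log (1 + chi v) := by
    rw [hhalf] at hext'
    exact (div_left_inj' hv.ne').1 hext'
  obtain ⟨p, hp, z, hz, w, hw, h⟩ := exists_JH_eq hc hne.nonempty
  have hd : ∀ a ∈ E, ∀ b ∈ E, dist a b ≤ 2 * v := fun a ha b hb => by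
    rw [← hhalf, mul_div_cancel₀ _ two_ne_zero]
    exact Metric.dist_le_diam_of_mem hc.isBounded ha hb
  have hpim := p.im_pos
  have heq : dist (z : ℂ) w / p.im = chi v := by
    have h3 := div_nonneg (dist_nonneg (x := (z : ℂ)) (y := w)) hpim.le
    have h4 := chi_pos hv
    have := Real.log_injOn_pos (Set.mem_Ioi.2 (by linarith)) (Set.mem_Ioi.2 (by linarith))
      (h.symm.trans hJ)
    linarith
  obtain ⟨hzim, hwim, hre⟩ := eq_of_dist_div_im_eq_chi hv hv0.le (hd z hz p hp) (hd w hw p hp)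
    (hd z hz w hw) heq
  have hlt : p.im < p.im * height v := by nlinarith [one_lt_height hv]
  -- the base points lie strictly above `p`, so the three points are distinct and exhaust `E`
  have hpz : p ≠ z := fun h => by
    rw [← h] at hzim
    exact hlt.ne hzim
  have hpw : p ≠ w := fun h => by
    rw [← h] at hwim
    exact hlt.ne hwim
  have hzw : z ≠ w := fun h => by
    rw [h, dist_self, zero_div] at heq
    exact (chi_pos hv).ne heq
  have hset : E = {p, z, w} := by
    symm
    apply Set.eq_of_subset_of_ncard_le _ _ hfin
    · rintro a (rfl | rfl | rfl) <;> assumption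
    · rw [hE, Set.ncard_eq_three.2 ⟨p, z, w, hpz, hpw, hzw, rfl⟩]
  have hp' : (p : ℂ) = (p.im : ℂ) * ((UpperHalfPlane.I : ℍ) : ℂ) + (p.re : ℂ) :=
    coe_eq_of_re_im (by simp) (by simp)
  refine ⟨p.im, p.re, hpim, ?_⟩
  rw [hset, toC, toC, triple]
  simp only [Set.image_insert_eq, Set.image_singleton]
  rw [← hp']
  rcases hre with ⟨ha, hb⟩ | ⟨ha, hb⟩
  · rw [coe_eq_of_re_im (z := z) (p := p) (q := wPt v) (by rw [wPt_re hv.le, ha])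
        (by rw [wPt_im hv.le, hzim]),
      coe_eq_of_re_im (z := w) (p := p) (q := zPt v) (by rw [zPt_re hv.le, hb]; ring)
        (by rw [zPt_im hv.le, hwim]), Set.pair_comm]
  · rw [coe_eq_of_re_im (z := z) (p := p) (q := zPt v) (by rw [zPt_re hv.le, ha]; ring)
        (by rw [zPt_im hv.le, hzim]),
      coe_eq_of_re_im (z := w) (p := p) (q := wPt v) (by rw [wPt_re hv.le, hb])
        (by rw [wPt_im hv.le, hwim])]

end HypDiam

theorem theorem4p9 :
    ∃ u₀ : ℝ,
      -- the unique positive solution of the equation that defines it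
      (0 < u₀ ∧ 4 * Real.cosh u₀ ^ 4 = Real.cosh (4 * u₀) ∧
        (∀ v : ℝ, 0 < v → 4 * Real.cosh v ^ 4 = Real.cosh (4 * v) → v = u₀) ∧
        |u₀ - 0.831443| < 1 / 10 ^ 6) ∧
      ∃ u : ℝ, 0 < u ∧ u < u₀ ∧
        -- a critical point
        HasDerivAt HypDiam.xi 0 u ∧
        -- the value of the constant
        HypDiam.kappaH = HypDiam.xi u ∧
        HypDiam.kappaH = dist (HypDiam.zPt u) (HypDiam.wPt u) /
          Real.log (1 + ‖((HypDiam.zPt u : ℍ) : ℂ) - ((HypDiam.wPt u : ℍ) : ℂ)‖) ∧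
        -- the extremum is attained by the equilateral triple of side length 2u
        HypDiam.kappaH =
          HypDiam.hH (HypDiam.triple u) / HypDiam.JH (HypDiam.triple u) ∧
        dist UpperHalfPlane.I (HypDiam.zPt u) = 2 * u ∧
        dist UpperHalfPlane.I (HypDiam.wPt u) = 2 * u ∧
        dist (HypDiam.zPt u) (HypDiam.wPt u) = 2 * u ∧
        -- uniqueness up to affine maps preserving the half-plane
        ∀ E : Set ℍ, E.ncard = 3 →
          HypDiam.kappaH = HypDiam.hH E / HypDiam.JH E →
          ∃ a b : ℝ, 0 < a ∧
            HypDiam.toC E =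
              (fun z : ℂ => (a : ℂ) * z + (b : ℂ)) '' HypDiam.toC (HypDiam.triple u) := by
  obtain ⟨v, hv, hv0, hlt⟩ := HypDiam.exists_unique_max
  have hmax : ∀ u, 0 < u →
      Real.log (1 + HypDiam.maxDist u) / u ≤ Real.log (1 + HypDiam.chi v) / v := by
    intro u hu
    rcases eq_or_ne u v with rfl | h
    · rw [HypDiam.maxDist, if_pos hv0.le]
    · exact (hlt u hu h).le
  have hk := HypDiam.kappaH_eq_xi hv hmax
  refine ⟨HypDiam.uZero, ⟨HypDiam.uZero_pos,
    (HypDiam.cosh_eq_iff_sinh _).2 HypDiam.sinh_uZero_sq, fun w hw h => HypDiam.eq_uZero hw h,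
    HypDiam.abs_uZero_sub_lt⟩, v, hv, hv0, HypDiam.hasDerivAt_xi_zero hv hv0 hmax, hk, ?_,
    hk.trans (HypDiam.hH_div_JH_triple hv).symm, HypDiam.dist_I_zPt hv.le,
    HypDiam.dist_I_wPt hv.le, HypDiam.dist_zPt_wPt hv.le, fun E hE h => ?_⟩
  · rw [hk, HypDiam.dist_zPt_wPt hv.le, ← dist_eq_norm, HypDiam.dist_coe_zPt_wPt hv,
      HypDiam.xi]
  · exact HypDiam.exists_affine_of_extremal hv hv0 hlt hE (hk.symm.trans h)
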